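/- Let $n\ge 1$, let $p\in(n,\infty)$, and let $\rho$ be a signed Borel measure on $\mathbb R^n$ with compact support such that $\rho(\mathbb R^n)=0$ and $\int_{\mathbb R^n}y\,d\rho(y)\neq 0$. Let $$\mathcal D^{1,p}(\mathbb R^n)=\{u\in L^1_{\mathrm{loc}}(\mathbb R^n): u_{x_i}\in L^p(\mathbb R^n)\text{ for } i=1,\dots,n\},$$ where $u_{x_i}$ are weak derivatives. Each $u\in\mathcal D^{1,p}(\mathbb R^n)$ agrees almost everywhere with exactly one function satisfying $|u(x)-u(y)|\le C|x-y|^{1-n/p}$ for all $x,y\in\mathbb R^n$ and some constant $C$, and $u$ is identified with this representative. Let $\mathcal S(n)$ be the set of similarity transformations $S(y)=\lambda Oy+z$ of $\mathbb R^n$ with $\lambda>0$, $O\in\mathrm O(n)$, $z\in\mathbb R^n$, let $S_\#\rho$ be the push-forward $(S_\#\rho)(A)=\rho(S^{-1}(A))$, and set $$[u]_\rho:=\sup\left\{\frac{\left|\int_{\mathbb R^n}u(x)\,d\mu(x)\right|}{\left|\int_{\mathbb R^n}x\,d\mu(x)\right|^{1-n/p}}:\ \mu=S_\#\rho,\ S\in\mathcal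 S(n)\right\}.$$ Then for each $u\in\mathcal D^{1,p}(\mathbb R^n)$ this supremum is finite and attained: there is $S\in\mathcal S(n)$ such that, with $\mu=S_\#\rho$, $$[u]_\rho=\frac{\left|\int_{\mathbb R^n}u(x)\,d\mu(x)\right|}{\left|\int_{\mathbb R^n}x\,d\mu(x)\right|^{1-n/p}}.$$ -/

import Mathlib

open MeasureTheory
open scoped ContDiff ENNReal

noncomputable section

/-- `g` is the weak partial derivative `∂u/∂xᵢ` on `ℝⁿ`, tested against smooth compactly supported
functions. -/
def HasWeakPartialDeriv {n : ℕ} (u : EuclideanSpace ℝ (Fin n) → ℝ) (i : Fin n)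
    (g : EuclideanSpace ℝ (Fin n) → ℝ) : Prop :=
  ∀ φ : EuclideanSpace ℝ (Fin n) → ℝ, ContDiff ℝ ∞ φ → HasCompactSupport φ →
    ∫ x, u x * fderiv ℝ φ x (EuclideanSpace.single i 1) = -∫ x, g x * φ x

/-- Membership in the homogeneous Sobolev space `𝒟^{1,p}(ℝⁿ)`: `u` is locally integrable and each
weak partial derivative exists and lies in `L^p(ℝⁿ)`. -/
def MemHomSobolev {n : ℕ} (p : ℝ) (u : EuclideanSpace ℝ (Fin n) → ℝ) : Prop :=
  LocallyIntegrable u volume ∧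
    ∀ i : Fin n, ∃ g : EuclideanSpace ℝ (Fin n) → ℝ,
      MemLp g (ENNReal.ofReal p) volume ∧ HasWeakPartialDeriv u i g

/-- `v` is a representative of the almost-everywhere class of `u` that is Hölder continuous on `ℝⁿ`
with exponent `1 - n/p`. -/
def IsHolderRepresentative {n : ℕ} (p : ℝ) (u v : EuclideanSpace ℝ (Fin n) → ℝ) : Prop :=
  v =ᵐ[volume] u ∧ ∃ C : ℝ, ∀ x y, |v x - v y| ≤ C * ‖x - y‖ ^ (1 - (n : ℝ) / p)

/-- The set `𝒮(n)` of similarity transformations `y ↦ λ O y + z` of `ℝⁿ`, with `λ > 0`, `O` in the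
orthogonal group (the linear isometries of `ℝⁿ`) and `z ∈ ℝⁿ`. -/
def similarities (n : ℕ) : Set (EuclideanSpace ℝ (Fin n) → EuclideanSpace ℝ (Fin n)) :=
  {S | ∃ (c : ℝ) (O : EuclideanSpace ℝ (Fin n) ≃ₗᵢ[ℝ] EuclideanSpace ℝ (Fin n))
      (z : EuclideanSpace ℝ (Fin n)), 0 < c ∧ S = fun y => c • O y + z}

/-- The first moment `∫ y dμ(y) ∈ ℝⁿ` of a signed Borel measure. -/
def firstMoment {n : ℕ} (μ : SignedMeasure (EuclideanSpace ℝ (Fin n))) :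
    EuclideanSpace ℝ (Fin n) :=
  ∫ᵛ y, y ∂<•μ

/-- The standing assumptions on the signed Borel measure `ρ`: its support (that of its total
variation) is compact, `ρ(ℝⁿ) = 0`, and its first moment does not vanish. -/
structure IsAdmissible {n : ℕ} (ρ : SignedMeasure (EuclideanSpace ℝ (Fin n))) : Prop where
  isCompact_support : IsCompact ρ.totalVariation.support
  univ_eq_zero : ρ Set.univ = 0
  firstMoment_ne_zero : firstMoment ρ ≠ 0

/-- The ratio `|∫ u dμ| / |∫ x dμ|^{1 - n/p}`. -/
def rhoRatio {n : ℕ} (p : ℝ) (u : EuclideanSpace ℝ (Fin n) → ℝ)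
    (μ : SignedMeasure (EuclideanSpace ℝ (Fin n))) : ℝ :=
  |∫ᵛ x, u x ∂•μ| / ‖firstMoment μ‖ ^ (1 - (n : ℝ) / p)

/-- The seminorm `[u]_ρ`: the supremum of the ratios over all push-forwards `μ = S_# ρ`, `S ∈ 𝒮(n)`.
It is taken in `[0, ∞]`, so that it is a genuine supremum with no boundedness presupposed. -/
def rhoSeminorm {n : ℕ} (p : ℝ) (ρ : SignedMeasure (EuclideanSpace ℝ (Fin n)))
    (u : EuclideanSpace ℝ (Fin n) → ℝ) : ℝ≥0∞ :=
  ⨆ S ∈ similarities n, ENNReal.ofReal (rhoRatio p u (ρ.map S))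

end

/-! A similarity is a triple (c, T, z), and the ratio is continuous in it, so the only obstruction
to a maximum is escape to c → 0, c → ∞ or |z| → ∞. Since ρ has total mass 0, only the oscillation of
u on the ball of radius cM about z enters, where |y| ≤ M for ρ-almost all y. This oscillation is
o(c^(1-n/p)) in each of the three limits (`IsHolderRepresentative.exists_abs_sub_le`), while the
denominator is a constant times c^(1-n/p). Hence the ratio drops below any positive value off a
compact set (`IsHolderRepresentative.exists_rhoRatio_lt`).

The oscillation bound is Morrey's inequality, proved by telescoping mollifications over dyadic
scales (`abs_sub_le_of_norm_fderiv_mollify_le`). The smallness comes from writing each weak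
derivative as a part small in L^p plus a continuous one of compact support
(`MeasureTheory.MemLp.exists_abs_mollify_le`). -/

/-! ### Mollification and its pointwise bounds -/

section Mollification

open Metric Set Filter Topology ContinuousLinearMap

variable {n : ℕ}

/-- The mollification of `u` by the normalized bump function `φ`. -/
noncomputable def mollify (φ : ContDiffBump (0 : EuclideanSpace ℝ (Fin n)))
    (u : EuclideanSpace ℝ (Fin n) → ℝ) : EuclideanSpace ℝ (Fin n) → ℝ :=
  convolution (φ.normed volume) u (lsmul ℝ ℝ) volume

variable (φ ψ : ContDiffBump (0 : EuclideanSpace ℝ (Fin n)))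
  {u g h : EuclideanSpace ℝ (Fin n) → ℝ}

theorem mollify_apply (u : EuclideanSpace ℝ (Fin n) → ℝ) (x : EuclideanSpace ℝ (Fin n)) :
    mollify φ u x = ∫ y, φ.normed volume (x - y) * u y := by
  simp [mollify, convolution_eq_swap]

theorem mollify_congr_ae (huv : u =ᵐ[volume] g) : mollify φ u = mollify φ g := by
  ext x
  rw [mollify_apply, mollify_apply]
  exact integral_congr_ae (huv.mono fun y hy ↦ by simp only [hy])

theorem hasFDerivAt_mollify (hu : LocallyIntegrable u volume) (x : EuclideanSpace ℝ (Fin n)) :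
    HasFDerivAt (mollify φ u)
      (convolution (fderiv ℝ (φ.normed volume)) u ((lsmul ℝ ℝ).precompL _) volume x) x :=
  φ.hasCompactSupport_normed.hasFDerivAt_convolution_left _ (φ.contDiff_normed (n := 1)) hu x

theorem continuous_mollify (hu : LocallyIntegrable u volume) : Continuous (mollify φ u) :=
  continuous_iff_continuousAt.2 fun x ↦ (hasFDerivAt_mollify φ hu x).continuousAt

theorem integrable_normed_sub_mul (hu : LocallyIntegrable u volume)
    (x : EuclideanSpace ℝ (Fin n)) :
    Integrable (fun y ↦ φ.normed volume (x - y) * u y) volume := by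
  have := φ.hasCompactSupport_normed.convolutionExists_left (lsmul ℝ ℝ)
    (φ.continuous_normed (μ := volume)) hu x
  simpa using! this.integrable_swap

theorem mollify_sub (hg : LocallyIntegrable g volume) (hh : LocallyIntegrable h volume)
    (x : EuclideanSpace ℝ (Fin n)) :
    mollify φ (g - h) x = mollify φ g x - mollify φ h x := by
  simp only [mollify_apply]
  rw [← integral_sub (integrable_normed_sub_mul φ hg x) (integrable_normed_sub_mul φ hh x)]
  simp [mul_sub]

/-- The weak derivative is tested against y ↦ φ(x - y); the sign from this reflection cancels the
one from integration by parts. -/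
theorem fderiv_mollify_single {i : Fin n} (hu : LocallyIntegrable u volume)
    (hg : HasWeakPartialDeriv u i g) (x : EuclideanSpace ℝ (Fin n)) :
    fderiv ℝ (mollify φ u) x (EuclideanSpace.single i 1) = mollify φ g x := by
  have hφ : ContDiff ℝ ∞ (φ.normed volume) := φ.contDiff_normed
  have hφd := hφ.differentiable (by simp)
  have key := hg (fun y ↦ φ.normed volume (x - y)) (hφ.comp (contDiff_const.sub contDiff_id))
    (φ.hasCompactSupport_normed.comp_homeomorph (Homeomorph.subLeft x))
  have hd : ∀ y, fderiv ℝ (fun y ↦ φ.normed volume (x - y)) y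
      = - fderiv ℝ (φ.normed volume) (x - y) := fun y ↦ by
    have : HasFDerivAt (fun y ↦ φ.normed volume (x - y)) _ y :=
      (hφd (x - y)).hasFDerivAt.comp y ((hasFDerivAt_id y).const_sub x)
    rw [this.fderiv]
    ext v
    simp
  have hint := ((φ.hasCompactSupport_normed (μ := volume)).fderiv ℝ).convolutionExists_left
    (μ := volume) ((lsmul ℝ ℝ).precompL (EuclideanSpace ℝ (Fin n)))
    (hφ.continuous_fderiv (by simp)) hu x
  rw [(hasFDerivAt_mollify φ hu x).fderiv, convolution_eq_swap,
    ContinuousLinearMap.integral_apply hint.integrable_swap, mollify_apply]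
  simp only [hd, neg_apply, mul_neg, integral_neg, neg_inj] at key
  simpa [mul_comm, precompL_apply] using key

theorem mollify_comm (hu : LocallyIntegrable u volume) (x : EuclideanSpace ℝ (Fin n)) :
    mollify φ (mollify ψ u) x = mollify ψ (mollify φ u) x := by
  have hu' : LocallyIntegrable (fun x ↦ ‖u x‖) volume := fun x ↦
    let ⟨s, hs, h⟩ := hu x
    ⟨s, hs, h.norm⟩
  have assoc : ∀ φ ψ : ContDiffBump (0 : EuclideanSpace ℝ (Fin n)),
      convolution (convolution (φ.normed volume) (ψ.normed volume) (lsmul ℝ ℝ) volume) u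
        (lsmul ℝ ℝ) volume x = mollify φ (mollify ψ u) x := fun φ ψ ↦ by
    have hc : Continuous (convolution (fun x ↦ ‖ψ.normed volume x‖) (fun x ↦ ‖u x‖)
        (mul ℝ ℝ) volume) :=
      ψ.hasCompactSupport_normed.norm.continuous_convolution_left _ ψ.continuous_normed.norm
        hu'
    refine convolution_assoc _ _ _ _ (fun a b c ↦ by simp [mul_assoc])
      φ.continuous_normed.aestronglyMeasurable ψ.continuous_normed.aestronglyMeasurable
      hu.aestronglyMeasurable
      (.of_forall (φ.hasCompactSupport_normed.convolutionExists_left _ φ.continuous_normed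
        ψ.continuous_normed.locallyIntegrable))
      (.of_forall (ψ.hasCompactSupport_normed.norm.convolutionExists_left _
        ψ.continuous_normed.norm hu')) ?_
    exact φ.hasCompactSupport_normed.norm.convolutionExists_left _ φ.continuous_normed.norm
      hc.locallyIntegrable x
  rw [← assoc, ← assoc]
  congr 1
  ext y
  rw [convolution_lsmul_swap, convolution_lsmul]
  simp [mul_comm]

/-- Fixing the ratio of the radii at 2 bounds the kernel by 2^n over the volume of its ball,
uniformly in the scale. -/
theorem abs_mollify_le_setLIntegral (x : EuclideanSpace ℝ (Fin n)) (hφ : φ.rOut = 2 * φ.rIn) :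
    ENNReal.ofReal |mollify φ g x| ≤
      ENNReal.ofReal (2 ^ n / volume.real (closedBall (0 : EuclideanSpace ℝ (Fin n)) φ.rOut)) *
        eLpNorm g 1 (volume.restrict (closedBall x φ.rOut)) := by
  set K := 2 ^ n / volume.real (closedBall (0 : EuclideanSpace ℝ (Fin n)) φ.rOut)
  rw [mollify_apply, eLpNorm_one_eq_lintegral_enorm,
    ← lintegral_const_mul' _ _ ENNReal.ofReal_ne_top]
  refine le_trans (Real.enorm_eq_ofReal_abs _ ▸ enorm_integral_le_lintegral_enorm
    (fun y ↦ φ.normed volume (x - y) * g y)) ?_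
  rw [← lintegral_indicator isClosed_closedBall.measurableSet]
  refine lintegral_mono fun y ↦ ?_
  by_cases hy : y ∈ closedBall x φ.rOut
  · rw [indicator_of_mem hy, enorm_mul]
    gcongr
    rw [Real.enorm_eq_ofReal_abs, abs_of_nonneg (φ.nonneg_normed _)]
    have := φ.normed_le_div_measure_closedBall_rOut volume 2 hφ.le (x - y)
    rw [finrank_euclideanSpace_fin] at this
    exact ENNReal.ofReal_le_ofReal this
  · rw [indicator_of_notMem hy]
    have : x - y ∉ Function.support (φ.normed volume) := by
      rw [φ.support_normed_eq]
      intro h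
      apply hy
      rw [mem_ball_zero_iff] at h
      rw [mem_closedBall, dist_comm, dist_eq_norm]
      exact h.le
    simp [Function.notMem_support.1 this]

/-- Hölder's inequality on the ball. The case p = 1 is included and yields the decay of order -n at
large scales. -/
theorem abs_mollify_le_eLpNorm (x : EuclideanSpace ℝ (Fin n)) (hφ : φ.rOut = 2 * φ.rIn)
    {p : ℝ} (hp : 1 ≤ p) (hg : MemLp g (ENNReal.ofReal p) volume) :
    |mollify φ g x| ≤ 2 ^ n * volume.real (closedBall (0 : EuclideanSpace ℝ (Fin n)) 1) ^ (-(1 / p))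
      * φ.rOut ^ (-(n / p)) * (eLpNorm g (ENNReal.ofReal p) volume).toReal := by
  have hp0 : 0 < p := by linarith
  have hr := φ.rOut_pos
  set V := volume.real (closedBall (0 : EuclideanSpace ℝ (Fin n)) φ.rOut) with hV
  set V₁ := volume.real (closedBall (0 : EuclideanSpace ℝ (Fin n)) 1)
  have hV1 : 0 < V₁ :=
    ENNReal.toReal_pos (measure_closedBall_pos _ _ one_pos).ne' measure_closedBall_lt_top.ne
  have hVe : V = φ.rOut ^ n * V₁ := by
    rw [hV, Measure.addHaar_real_closedBall' _ _ hr.le, finrank_euclideanSpace_fin]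
  have hV0 : 0 < V := by rw [hVe]; positivity
  have hvol : volume (closedBall x φ.rOut) = ENNReal.ofReal V := by
    rw [hV, Measure.real, ENNReal.ofReal_toReal measure_closedBall_lt_top.ne,
      Measure.addHaar_closedBall_center]
  have h1 := (abs_mollify_le_setLIntegral φ (g := g) x hφ).trans (mul_le_mul_right
    ((eLpNorm_le_eLpNorm_mul_rpow_measure_univ (μ := volume.restrict (closedBall x φ.rOut))
      (p := 1) (q := ENNReal.ofReal p) (by simpa using hp) hg.1.restrict).trans
      (mul_le_mul_left (eLpNorm_mono_measure g Measure.restrict_le_self) _)) _)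
  rw [Measure.restrict_apply_univ, hvol, ENNReal.toReal_one, ENNReal.toReal_ofReal hp0.le,
    ENNReal.ofReal_rpow_of_pos hV0] at h1
  rw [← ENNReal.ofReal_toReal hg.2.ne, ← ENNReal.ofReal_mul ENNReal.toReal_nonneg,
    ← ENNReal.ofReal_mul (by positivity), ENNReal.ofReal_le_ofReal_iff (by positivity)] at h1
  refine h1.trans_eq ?_
  have e : V ^ (1 / 1 - 1 / p) = V * (V₁ ^ (-(1 / p)) * φ.rOut ^ (-(n / p))) := by
    rw [div_one, sub_eq_add_neg, Real.rpow_add hV0, Real.rpow_one]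
    congr 1
    rw [hVe, Real.mul_rpow (by positivity) hV1.le, mul_comm, ← Real.rpow_natCast,
      ← Real.rpow_mul hr.le]
    congr 2
    ring
  rw [e, ← hV]
  field_simp

end Mollification

/-! ### Gradient bounds for mollified functions -/

section GradientBounds

open Metric Set Filter Topology

variable {n : ℕ}

theorem norm_le_sum_abs_apply_single (L : EuclideanSpace ℝ (Fin n) →L[ℝ] ℝ) :
    ‖L‖ ≤ ∑ i, |L (EuclideanSpace.single i 1)| := by
  refine L.opNorm_le_bound (Finset.sum_nonneg fun i _ ↦ abs_nonneg _) fun v ↦ ?_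
  have hv : L v = ∑ i, v i * L (EuclideanSpace.single i 1) := by
    conv_lhs => rw [← (EuclideanSpace.basisFun (Fin n) ℝ).sum_repr v]
    simp
  rw [hv, Finset.sum_mul]
  refine (norm_sum_le _ _).trans (Finset.sum_le_sum fun i _ ↦ ?_)
  rw [norm_mul, mul_comm]
  exact mul_le_mul_of_nonneg_left (PiLp.norm_apply_le v i) (abs_nonneg _)

variable (φ ψ : ContDiffBump (0 : EuclideanSpace ℝ (Fin n)))
  {u g h : EuclideanSpace ℝ (Fin n) → ℝ}

theorem norm_fderiv_mollify_le {g : Fin n → EuclideanSpace ℝ (Fin n) → ℝ}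
    (hu : LocallyIntegrable u volume) (hg : ∀ i, HasWeakPartialDeriv u i (g i))
    (x : EuclideanSpace ℝ (Fin n)) :
    ‖fderiv ℝ (mollify φ u) x‖ ≤ ∑ i, |mollify φ (g i) x| := by
  simpa only [fderiv_mollify_single φ hu (hg _)] using
    norm_le_sum_abs_apply_single (fderiv ℝ (mollify φ u) x)

theorem abs_mollify_le_of_bound {B : ℝ} (hB : ∀ y, |h y| ≤ B) (x : EuclideanSpace ℝ (Fin n)) :
    |mollify φ h x| ≤ B := by
  rw [mollify_apply]
  have hint : Integrable (fun y ↦ φ.normed volume (x - y)) volume :=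
    (φ.integrable_normed (μ := volume)).comp_sub_left x
  refine (norm_integral_le_of_norm_le (G := ℝ) (hint.mul_const B)
    (.of_forall fun y ↦ ?_)).trans_eq ?_
  · rw [norm_mul, Real.norm_of_nonneg (φ.nonneg_normed _)]
    exact mul_le_mul_of_nonneg_left (hB y) (φ.nonneg_normed _)
  · rw [integral_mul_const, integral_sub_left_eq_self (φ.normed volume), φ.integral_normed, one_mul]

theorem mollify_eq_zero {R : ℝ} (hh : ∀ y, R < ‖y‖ → h y = 0) {x : EuclideanSpace ℝ (Fin n)}
    (hx : R + φ.rOut < ‖x‖) : mollify φ h x = 0 := by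
  rw [mollify_apply]
  refine integral_eq_zero_of_ae (.of_forall fun y ↦ ?_)
  by_cases hy : R < ‖y‖
  · simp [hh y hy]
  · have : x - y ∉ Function.support (φ.normed volume) := by
      rw [φ.support_normed_eq, mem_ball_zero_iff]
      have := norm_sub_norm_le x y
      linarith
    simp [Function.notMem_support.1 this]

/-- Mollifications of an `L^p` function `g` are of size `η * ε ^ (-n/p)` at scale `ε`, up to the
mollification of a bounded function of compact support. -/
theorem MeasureTheory.MemLp.exists_abs_mollify_le {p : ℝ} (hp : 1 ≤ p)
    (hg : MemLp g (ENNReal.ofReal p) volume) {η : ℝ} (hη : 0 < η) :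
    ∃ K, 0 ≤ K ∧ ∃ R, ∀ φ : ContDiffBump (0 : EuclideanSpace ℝ (Fin n)), φ.rOut = 2 * φ.rIn →
      ∀ x, (∀ θ : ℝ, 0 ≤ θ → θ ≤ n →
        |mollify φ g x| ≤ η * φ.rOut ^ (-(n / p)) + K * φ.rOut ^ (-θ)) ∧
      (R + φ.rOut < ‖x‖ → |mollify φ g x| ≤ η * φ.rOut ^ (-(n / p))) := by
  set V₁ := volume.real (closedBall (0 : EuclideanSpace ℝ (Fin n)) 1)
  have hV1 : 0 < V₁ :=
    ENNReal.toReal_pos (measure_closedBall_pos _ _ one_pos).ne' measure_closedBall_lt_top.ne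
  set C := 2 ^ n * V₁ ^ (-(1 / p)) with hC
  have hC0 : 0 < C := by positivity
  obtain ⟨h, hsupp, hgh, hcont, hmem⟩ := hg.exists_hasCompactSupport_eLpNorm_sub_le
    ENNReal.ofReal_ne_top (ε := ENNReal.ofReal (η / C)) (by simpa using div_pos hη hC0)
  obtain ⟨B, hB⟩ := hcont.bounded_above_of_compact_support hsupp
  obtain ⟨R, hR⟩ := hsupp.isBounded.subset_closedBall 0
  have hR' : ∀ y, R < ‖y‖ → h y = 0 := fun y hy ↦ image_eq_zero_of_notMem_tsupport fun hy' ↦ by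
    have := hR hy'
    rw [mem_closedBall_zero_iff] at this
    linarith
  have hB0 : 0 ≤ B := (norm_nonneg _).trans (hB 0)
  have h1 : MemLp h (ENNReal.ofReal 1) volume := by
    rw [ENNReal.ofReal_one, memLp_one_iff_integrable]
    exact hcont.integrable_of_hasCompactSupport hsupp
  set K₁ := 2 ^ n * V₁ ^ (-(1 / 1 : ℝ)) * (eLpNorm h (ENNReal.ofReal 1) volume).toReal with hK₁
  have hK₁0 : 0 ≤ K₁ := by positivity
  have hp' : (1 : ℝ≥0∞) ≤ ENNReal.ofReal p := by simpa using hp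
  refine ⟨max B K₁, hB0.trans (le_max_left _ _), R, fun φ hφ x ↦ ?_⟩
  have hr := φ.rOut_pos
  have hsub : |mollify φ (g - h) x| ≤ η * φ.rOut ^ (-(n / p)) := by
    refine (abs_mollify_le_eLpNorm φ x hφ hp (hg.sub hmem)).trans ?_
    have := ENNReal.toReal_le_of_le_ofReal (by positivity) hgh
    calc _ ≤ C * φ.rOut ^ (-(n / p)) * (η / C) := by gcongr
      _ = _ := by field_simp
  have hsplit : mollify φ g x = mollify φ (g - h) x + mollify φ h x := by
    rw [mollify_sub φ (hg.locallyIntegrable hp') (hmem.locallyIntegrable hp'), sub_add_cancel]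
  refine ⟨fun θ hθ0 hθn ↦ ?_, fun hx ↦ ?_⟩
  · rw [hsplit]
    refine (abs_add_le _ _).trans (add_le_add hsub ?_)
    -- The sup bound B serves scales below 1 and the L¹ bound scales above 1; every exponent θ in
    -- [0, n] interpolates between them.
    rcases le_total φ.rOut 1 with hle | hge
    · calc |mollify φ h x| ≤ B := abs_mollify_le_of_bound φ hB x
        _ ≤ max B K₁ := le_max_left _ _
        _ ≤ max B K₁ * φ.rOut ^ (-θ) := le_mul_of_one_le_right (hB0.trans (le_max_left _ _))
          (Real.one_le_rpow_of_pos_of_le_one_of_nonpos hr hle (by linarith))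
    · calc |mollify φ h x| ≤ K₁ * φ.rOut ^ (-(n : ℝ)) := by
            refine (abs_mollify_le_eLpNorm φ x hφ le_rfl h1).trans_eq ?_
            rw [hK₁, div_one (n : ℝ)]
            ring
        _ ≤ max B K₁ * φ.rOut ^ (-θ) := by
            gcongr
            · exact le_max_right _ _
  · rwa [hsplit, mollify_eq_zero φ hR' hx, add_zero]

theorem MemHomSobolev.exists_norm_fderiv_mollify_le {p : ℝ} (hp : 1 ≤ p) (hn : 0 < n)
    (hu : MemHomSobolev p u) {η : ℝ} (hη : 0 < η) :
    ∃ K, 0 ≤ K ∧ ∃ R, ∀ φ : ContDiffBump (0 : EuclideanSpace ℝ (Fin n)), φ.rOut = 2 * φ.rIn →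
      ∀ x, (∀ θ : ℝ, 0 ≤ θ → θ ≤ n →
        ‖fderiv ℝ (mollify φ u) x‖ ≤ η * φ.rOut ^ (-(n / p)) + K * φ.rOut ^ (-θ)) ∧
      (R + φ.rOut < ‖x‖ → ‖fderiv ℝ (mollify φ u) x‖ ≤ η * φ.rOut ^ (-(n / p))) := by
  have hn' : (0 : ℝ) < n := by exact_mod_cast hn
  choose g hgp hg using hu.2
  choose K hK0 R H using fun i ↦ (hgp i).exists_abs_mollify_le hp (div_pos hη hn')
  refine ⟨∑ i, K i, Finset.sum_nonneg fun i _ ↦ hK0 i, ∑ i, |R i|, fun φ hφ x ↦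
    ⟨fun θ h0 h1 ↦ ?_, fun hx ↦ ?_⟩⟩
  · refine (norm_fderiv_mollify_le φ hu.1 hg x).trans
      ((Finset.sum_le_sum fun i _ ↦ (H i φ hφ x).1 θ h0 h1).trans_eq ?_)
    rw [Finset.sum_add_distrib, Finset.sum_const, Finset.card_univ, Fintype.card_fin, nsmul_eq_mul,
      Finset.sum_mul, ← mul_assoc, mul_div_cancel₀ _ hn'.ne']
  · refine (norm_fderiv_mollify_le φ hu.1 hg x).trans
      ((Finset.sum_le_sum fun i _ ↦ (H i φ hφ x).2 ?_).trans_eq ?_)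
    · have := Finset.single_le_sum (fun j _ ↦ abs_nonneg (R j)) (Finset.mem_univ i)
      linarith [le_abs_self (R i)]
    · rw [Finset.sum_const, Finset.card_univ, Fintype.card_fin, nsmul_eq_mul]
      field_simp

end GradientBounds

/-! ### Morrey's oscillation estimate -/

section Oscillation

open Metric Set Filter Topology

variable {n : ℕ} {u : EuclideanSpace ℝ (Fin n) → ℝ}

theorem dist_mollify_mollify_le (φ ψ : ContDiffBump (0 : EuclideanSpace ℝ (Fin n)))
    (hu : LocallyIntegrable u volume) {x : EuclideanSpace ℝ (Fin n)} {M : ℝ}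
    (h : ∀ y ∈ ball x ψ.rOut, ‖fderiv ℝ (mollify φ u) y‖ ≤ M) :
    dist (mollify ψ (mollify φ u) x) (mollify φ u x) ≤ M * ψ.rOut := by
  have hx : x ∈ ball x ψ.rOut := mem_ball_self ψ.rOut_pos
  have hM : 0 ≤ M := (norm_nonneg _).trans (h x hx)
  refine ψ.dist_normed_convolution_le (continuous_mollify φ hu).aestronglyMeasurable
    fun y hy ↦ ?_
  rw [dist_eq_norm]
  refine ((convex_ball x ψ.rOut).norm_image_sub_le_of_norm_fderiv_le (𝕜 := ℝ)
    (fun z _ ↦ (hasFDerivAt_mollify φ hu z).differentiableAt) h hx hy).trans ?_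
  rw [← dist_eq_norm]
  gcongr
  exact (mem_ball.1 hy).le

/-- Both mollifications are compared with the double one, which does not depend on the order; only
gradient bounds on mollified functions are needed. -/
theorem dist_mollify_le (φ ψ : ContDiffBump (0 : EuclideanSpace ℝ (Fin n)))
    (hu : LocallyIntegrable u volume) {x : EuclideanSpace ℝ (Fin n)} {M N : ℝ}
    (hφ : ∀ y ∈ ball x ψ.rOut, ‖fderiv ℝ (mollify φ u) y‖ ≤ M)
    (hψ : ∀ y ∈ ball x φ.rOut, ‖fderiv ℝ (mollify ψ u) y‖ ≤ N) :
    dist (mollify φ u x) (mollify ψ u x) ≤ M * ψ.rOut + N * φ.rOut := by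
  have h1 := dist_mollify_mollify_le φ ψ hu hφ
  have h2 := dist_mollify_mollify_le ψ φ hu hψ
  rw [mollify_comm φ ψ hu] at h2
  rw [dist_comm] at h1
  exact (dist_triangle _ _ _).trans (add_le_add h1 h2)

/-- The bump function at the origin with inner radius `r / 2 ^ (k + 1)` and outer radius
`r / 2 ^ k`. -/
noncomputable def dyadicBump (n : ℕ) {r : ℝ} (hr : 0 < r) (k : ℕ) :
    ContDiffBump (0 : EuclideanSpace ℝ (Fin n)) where
  rIn := r / 2 ^ (k + 1)
  rOut := r / 2 ^ k
  rIn_pos := by positivity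
  rIn_lt_rOut := by gcongr <;> simp

theorem dyadicBump_rOut {r : ℝ} (hr : 0 < r) (k : ℕ) : (dyadicBump n hr k).rOut = r / 2 ^ k := rfl

theorem dyadicBump_rOut_eq {r : ℝ} (hr : 0 < r) (k : ℕ) :
    (dyadicBump n hr k).rOut = 2 * (dyadicBump n hr k).rIn := by
  simp only [dyadicBump]
  rw [pow_succ]
  field_simp

theorem dyadicBump_rOut_le {r : ℝ} (hr : 0 < r) (k : ℕ) : (dyadicBump n hr k).rOut ≤ r :=
  div_le_self hr.le (one_le_pow₀ one_le_two)

theorem tendsto_dyadicBump_rOut {r : ℝ} (hr : 0 < r) :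
    Tendsto (fun k ↦ (dyadicBump n hr k).rOut) atTop (𝓝 0) := by
  have := (tendsto_pow_atTop_nhds_zero_of_lt_one (r := (1 / 2 : ℝ)) (by norm_num)
    (by norm_num)).const_mul r
  simpa [dyadicBump_rOut, div_eq_mul_inv] using this

theorem div_two_pow_rpow {r : ℝ} (hr : 0 < r) (k : ℕ) (θ : ℝ) :
    (r / 2 ^ k) * (r / 2 ^ k) ^ (-θ) = r ^ (1 - θ) * ((2 : ℝ) ^ (θ - 1)) ^ k := by
  have h : 0 < r / 2 ^ k := by positivity
  nth_rewrite 1 [← Real.rpow_one (r / 2 ^ k)]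
  rw [← Real.rpow_add h, ← sub_eq_add_neg, Real.div_rpow hr.le (by positivity),
    ← Real.rpow_pow_comm two_pos.le, div_eq_mul_inv, ← inv_pow, ← Real.rpow_neg two_pos.le, neg_sub]

theorem two_rpow_sub_one_lt_one {θ : ℝ} (hθ : θ < 1) : (2 : ℝ) ^ (θ - 1) < 1 :=
  Real.rpow_lt_one_of_one_lt_of_neg one_lt_two (by linarith)

/-- Halving the scale costs a factor 2^θ ≤ 2, and 1/2 + 2 ≤ 3. -/
theorem dyadic_step_le {s M θ : ℝ} (hs : 0 < s) (hM : 0 ≤ M) (hθ : θ ≤ 1) :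
    M * s ^ (-θ) * (s / 2) + M * (s / 2) ^ (-θ) * s ≤ 3 * M * (s * s ^ (-θ)) := by
  have h2 : (s / 2) ^ (-θ) ≤ 2 * s ^ (-θ) := by
    rw [Real.div_rpow hs.le two_pos.le, div_eq_mul_inv, ← Real.rpow_neg two_pos.le, neg_neg,
      mul_comm]
    gcongr
    simpa using Real.rpow_le_rpow_of_exponent_le one_le_two hθ
  have h3 : 0 ≤ M * s ^ (-θ) * s := by positivity
  nlinarith [mul_le_mul_of_nonneg_left h2 (mul_nonneg hM hs.le)]

variable {r M₁ M₂ θ₁ θ₂ : ℝ} {z : EuclideanSpace ℝ (Fin n)}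

theorem dist_mollify_dyadicBump_succ_le (hu : LocallyIntegrable u volume) (hr : 0 < r)
    (hM₁ : 0 ≤ M₁) (hM₂ : 0 ≤ M₂) (hθ₁ : θ₁ ≤ 1) (hθ₂ : θ₂ ≤ 1)
    (H : ∀ φ : ContDiffBump (0 : EuclideanSpace ℝ (Fin n)), φ.rOut = 2 * φ.rIn → φ.rOut ≤ r →
      ∀ y ∈ ball z (3 * r), ‖fderiv ℝ (mollify φ u) y‖ ≤
        M₁ * φ.rOut ^ (-θ₁) + M₂ * φ.rOut ^ (-θ₂))
    {x : EuclideanSpace ℝ (Fin n)} (hx : x ∈ closedBall z r) (k : ℕ) :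
    dist (mollify (dyadicBump n hr k) u x) (mollify (dyadicBump n hr (k + 1)) u x) ≤
      3 * M₁ * (r ^ (1 - θ₁) * ((2 : ℝ) ^ (θ₁ - 1)) ^ k) +
        3 * M₂ * (r ^ (1 - θ₂) * ((2 : ℝ) ^ (θ₂ - 1)) ^ k) := by
  have hball : ∀ k, ball x (dyadicBump n hr k).rOut ⊆ ball z (3 * r) := fun k ↦
    ball_subset_ball' (by linarith [dyadicBump_rOut_le (n := n) hr k, mem_closedBall.1 hx])
  have h := dist_mollify_le (dyadicBump n hr k) (dyadicBump n hr (k + 1)) hu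
    (fun y hy ↦ H _ (dyadicBump_rOut_eq hr _) (dyadicBump_rOut_le hr _) y (hball _ hy))
    (fun y hy ↦ H _ (dyadicBump_rOut_eq hr _) (dyadicBump_rOut_le hr _) y (hball _ hy))
  have hk : 0 < r / 2 ^ k := by positivity
  have e : r / 2 ^ (k + 1) = r / 2 ^ k / 2 := by rw [pow_succ, div_div]
  rw [dyadicBump_rOut, dyadicBump_rOut, e] at h
  rw [← div_two_pow_rpow hr, ← div_two_pow_rpow hr]
  linarith [dyadic_step_le hk hM₁ hθ₁, dyadic_step_le hk hM₂ hθ₂]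

/-- The constant in Morrey's inequality for the exponent `θ = n / p`. -/
noncomputable def morreyConst (θ : ℝ) : ℝ := 8 / (1 - 2 ^ (θ - 1))

theorem morreyConst_pos {θ : ℝ} (hθ : θ < 1) : 0 < morreyConst θ :=
  div_pos (by norm_num) (sub_pos.2 (two_rpow_sub_one_lt_one hθ))

theorem hasSum_dyadic (r M : ℝ) {θ : ℝ} (hθ : θ < 1) :
    HasSum (fun k : ℕ ↦ 3 * M * (r ^ (1 - θ) * ((2 : ℝ) ^ (θ - 1)) ^ k))
      (3 * M * (r ^ (1 - θ) * (1 - 2 ^ (θ - 1))⁻¹)) :=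
  ((hasSum_geometric_of_lt_one (by positivity) (two_rpow_sub_one_lt_one hθ)).mul_left _).mul_left _

/-- Morrey's oscillation estimate on a ball, from gradient bounds on the mollifications. -/
theorem abs_sub_le_of_norm_fderiv_mollify_le (hu : Continuous u) (hr : 0 < r)
    (hM₁ : 0 ≤ M₁) (hM₂ : 0 ≤ M₂) (hθ₁ : θ₁ < 1) (hθ₂ : θ₂ < 1)
    (H : ∀ φ : ContDiffBump (0 : EuclideanSpace ℝ (Fin n)), φ.rOut = 2 * φ.rIn → φ.rOut ≤ r →
      ∀ y ∈ ball z (3 * r), ‖fderiv ℝ (mollify φ u) y‖ ≤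
        M₁ * φ.rOut ^ (-θ₁) + M₂ * φ.rOut ^ (-θ₂))
    {x y : EuclideanSpace ℝ (Fin n)} (hx : x ∈ closedBall z r) (hy : y ∈ closedBall z r) :
    |u x - u y| ≤ morreyConst θ₁ * M₁ * r ^ (1 - θ₁) + morreyConst θ₂ * M₂ * r ^ (1 - θ₂) := by
  have hlim : ∀ x ∈ closedBall z r, dist (mollify (dyadicBump n hr 0) u x) (u x) ≤
      3 * M₁ * (r ^ (1 - θ₁) * (1 - 2 ^ (θ₁ - 1))⁻¹) +
        3 * M₂ * (r ^ (1 - θ₂) * (1 - 2 ^ (θ₂ - 1))⁻¹) := fun x hx ↦ by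
    have hs := (hasSum_dyadic r M₁ hθ₁).add (hasSum_dyadic r M₂ hθ₂)
    rw [← hs.tsum_eq]
    exact dist_le_tsum_of_dist_le_of_tendsto₀ _ (fun k ↦ dist_mollify_dyadicBump_succ_le
      hu.locallyIntegrable hr hM₁ hM₂ hθ₁.le hθ₂.le H hx k) hs.summable
      (ContDiffBump.convolution_tendsto_right_of_continuous (tendsto_dyadicBump_rOut hr) hu x)
  have hsub : closedBall z r ⊆ ball z (3 * r) := closedBall_subset_ball (by linarith)
  have hmid := (convex_ball z (3 * r)).norm_image_sub_le_of_norm_fderiv_le (𝕜 := ℝ)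
    (fun z _ ↦ (hasFDerivAt_mollify (dyadicBump n hr 0) hu.locallyIntegrable z).differentiableAt)
    (H _ (dyadicBump_rOut_eq hr 0) (dyadicBump_rOut_le hr 0)) (hsub hy) (hsub hx)
  have hxy : ‖x - y‖ ≤ 2 * r := by
    rw [← dist_eq_norm]
    linarith [dist_triangle_right x y z, mem_closedBall.1 hx, mem_closedBall.1 hy]
  rw [dyadicBump_rOut, pow_zero, div_one] at hmid
  have e : ∀ θ : ℝ, r * r ^ (-θ) = r ^ (1 - θ) := fun θ ↦ by
    simpa only [pow_zero, div_one, mul_one] using div_two_pow_rpow hr 0 θ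
  -- The 8 in `morreyConst`: 3 from the telescoping series at each of the two points, 2 from the
  -- distance between them.
  have hone : ∀ {M θ : ℝ}, 0 ≤ M → θ < 1 → 6 * M * (r ^ (1 - θ) * (1 - 2 ^ (θ - 1))⁻¹)
      + 2 * M * r ^ (1 - θ) ≤ morreyConst θ * M * r ^ (1 - θ) := fun {M θ} hM hθ ↦ by
    have h1 : 1 ≤ (1 - (2 : ℝ) ^ (θ - 1))⁻¹ :=
      (one_le_inv₀ (sub_pos.2 (two_rpow_sub_one_lt_one hθ))).2 (by
        linarith [Real.rpow_pos_of_pos two_pos (θ - 1)])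
    have h2 : 0 ≤ M * r ^ (1 - θ) := by positivity
    rw [morreyConst, div_eq_mul_inv]
    nlinarith [mul_le_mul_of_nonneg_left h1 h2]
  have hmid' : |mollify (dyadicBump n hr 0) u x - mollify (dyadicBump n hr 0) u y| ≤
      2 * M₁ * r ^ (1 - θ₁) + 2 * M₂ * r ^ (1 - θ₂) := by
    refine hmid.trans ((mul_le_mul_of_nonneg_left hxy (by positivity)).trans_eq ?_)
    rw [← e, ← e]
    ring
  have h1 := hone hM₁ hθ₁
  have h2 := hone hM₂ hθ₂
  have h3 := hlim x hx
  have h4 := hlim y hy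
  rw [Real.dist_eq] at h3 h4
  have h5 : |u x - u y| ≤ |mollify (dyadicBump n hr 0) u x - u x| +
      |mollify (dyadicBump n hr 0) u y - u y| +
      |mollify (dyadicBump n hr 0) u x - mollify (dyadicBump n hr 0) u y| := by
    grind
  linarith

end Oscillation

/-! ### Hölder representative and vanishing oscillation -/

section HolderRepresentative

open Metric Set Filter Topology

variable {n : ℕ} {p : ℝ} {u v w : EuclideanSpace ℝ (Fin n) → ℝ}

theorem natCast_div_mem_Ico (hp : (n : ℝ) < p) : (n : ℝ) / p ∈ Ico (0 : ℝ) 1 := by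
  have hp0 : 0 < p := (Nat.cast_nonneg n).trans_lt hp
  exact ⟨by positivity, (div_lt_one hp0).2 hp⟩

theorem one_le_of_natCast_lt (hn : 0 < n) (hp : (n : ℝ) < p) : 1 ≤ p :=
  le_trans (by exact_mod_cast hn) hp.le

theorem IsHolderRepresentative.continuous (hp : (n : ℝ) < p) (hv : IsHolderRepresentative p u v) :
    Continuous v := by
  obtain ⟨C, hC⟩ := hv.2
  have hα : 0 < 1 - (n : ℝ) / p := sub_pos.2 (natCast_div_mem_Ico hp).2
  refine continuous_iff_continuousAt.2 fun x ↦ tendsto_iff_dist_tendsto_zero.2 ?_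
  refine squeeze_zero (fun _ ↦ dist_nonneg) (fun y ↦ hC y x) ?_
  have : Continuous fun y ↦ C * ‖y - x‖ ^ (1 - (n : ℝ) / p) :=
    continuous_const.mul ((continuous_id.sub continuous_const).norm.rpow_const
      fun _ ↦ Or.inr hα.le)
  simpa [Real.zero_rpow hα.ne'] using this.tendsto x

theorem IsHolderRepresentative.unique (hp : (n : ℝ) < p) (hv : IsHolderRepresentative p u v)
    (hw : IsHolderRepresentative p u w) : v = w :=
  (Continuous.ae_eq_iff_eq volume (hv.continuous hp) (hw.continuous hp)).1 (hv.1.trans hw.1.symm)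

/-- The dyadic mollifications are uniformly Cauchy, so their limit is continuous; it equals u almost
everywhere by Lebesgue differentiation. Morrey's estimate on the ball about x of radius |x - y| then
gives the Hölder bound. -/
theorem exists_isHolderRepresentative (hn : 0 < n) (hp : (n : ℝ) < p) (hu : MemHomSobolev p u) :
    ∃ v, IsHolderRepresentative p u v := by
  obtain ⟨hθ0, hθ1⟩ := natCast_div_mem_Ico hp
  set θ := (n : ℝ) / p
  have hn1 : (1 : ℝ) ≤ n := by exact_mod_cast hn
  obtain ⟨K, hK, R, H⟩ := hu.exists_norm_fderiv_mollify_le (one_le_of_natCast_lt hn hp) hn one_pos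
  have hH : ∀ φ : ContDiffBump (0 : EuclideanSpace ℝ (Fin n)), φ.rOut = 2 * φ.rIn → ∀ y,
      ‖fderiv ℝ (mollify φ u) y‖ ≤ (1 + K) * φ.rOut ^ (-θ) + 0 * φ.rOut ^ (-θ) :=
    fun φ hφ y ↦ ((H φ hφ y).1 θ hθ0 (hθ1.le.trans hn1)).trans_eq (by ring)
  have hM : 0 ≤ 1 + K := by linarith
  set A : ℕ → EuclideanSpace ℝ (Fin n) → ℝ := fun k ↦ mollify (dyadicBump n one_pos k) u
  have hstep : ∀ x k, dist (A k x) (A (k + 1) x) ≤ _ := fun x k ↦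
    dist_mollify_dyadicBump_succ_le (z := x) hu.1 one_pos hM le_rfl hθ1.le hθ1.le
      (fun φ hφ _ y _ ↦ hH φ hφ y) (mem_closedBall_self zero_le_one) k
  have hs := ((hasSum_dyadic 1 (1 + K) hθ1).add (hasSum_dyadic 1 0 hθ1)).summable
  choose v hv using fun x ↦
    cauchySeq_tendsto_of_complete (cauchySeq_of_dist_le_of_summable _ (hstep x) hs)
  have hcont : Continuous v := by
    refine TendstoUniformly.continuous (F := A) (p := atTop) ?_
      (Frequently.of_forall fun k ↦ continuous_mollify _ hu.1)
    rw [Metric.tendstoUniformly_iff]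
    intro ε hε
    have htail := tendsto_sum_nat_add
      fun k : ℕ ↦ 3 * (1 + K) * ((1 : ℝ) ^ (1 - θ) * ((2 : ℝ) ^ (θ - 1)) ^ k) +
        3 * 0 * ((1 : ℝ) ^ (1 - θ) * ((2 : ℝ) ^ (θ - 1)) ^ k)
    filter_upwards [htail.eventually (gt_mem_nhds hε)] with k hk x
    rw [dist_comm]
    refine (dist_le_tsum_of_dist_le_of_tendsto _ (hstep x) hs (hv x) k).trans_lt ?_
    simpa only [add_comm k] using hk
  have hae : v =ᵐ[volume] u := by
    filter_upwards [ContDiffBump.ae_convolution_tendsto_right_of_locallyIntegrable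
      (tendsto_dyadicBump_rOut (n := n) one_pos)
      (.of_forall fun k ↦ (dyadicBump_rOut_eq one_pos k).le) hu.1] with x hx
    exact tendsto_nhds_unique (hv x) hx
  refine ⟨v, hae, morreyConst θ * (1 + K), fun x y ↦ ?_⟩
  rcases eq_or_ne x y with rfl | hxy
  · simp only [sub_self, abs_zero]
    have := (morreyConst_pos hθ1).le
    positivity
  · have hr : 0 < ‖x - y‖ := norm_pos_iff.2 (sub_ne_zero.2 hxy)
    have := abs_sub_le_of_norm_fderiv_mollify_le (z := x) hcont hr hM le_rfl hθ1 hθ1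
      (fun φ hφ _ y _ ↦ by rw [mollify_congr_ae φ hae]; exact hH φ hφ y)
      (mem_closedBall_self hr.le) (y := y) (by rw [mem_closedBall, dist_comm, dist_eq_norm])
    simpa using this

theorem exists_rpow_le {θ c : ℝ} (hθ : 0 < θ) (hc : 0 < c) :
    ∃ a, 0 < a ∧ ∀ r, 0 < r → r < a → r ^ θ ≤ c :=
  ⟨c ^ θ⁻¹, by positivity, fun r hr hra ↦
    (Real.rpow_le_rpow hr.le hra.le hθ.le).trans_eq (Real.rpow_inv_rpow hc.le hθ.ne')⟩

/-- The oscillation of a function of `𝒟^{1,p}` on a ball of radius `r` is small compared with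
`r ^ (1 - n/p)` if the ball is very small, very large or far away. -/
theorem IsHolderRepresentative.exists_abs_sub_le (hn : 0 < n) (hp : (n : ℝ) < p)
    (hu : MemHomSobolev p u) (hv : IsHolderRepresentative p u v) {τ : ℝ} (hτ : 0 < τ) :
    ∃ a b Z : ℝ, 0 < a ∧ ∀ (z : EuclideanSpace ℝ (Fin n)) (r : ℝ), 0 < r →
      (r < a ∨ b < r ∨ Z < ‖z‖) → ∀ x ∈ closedBall z r, |v x - v z| ≤ τ * r ^ (1 - n / p) := by
  obtain ⟨hθ0, hθ1⟩ := natCast_div_mem_Ico hp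
  have hn1 : (1 : ℝ) ≤ n := by exact_mod_cast hn
  have hp0 : 0 < p := by linarith
  have hθ : 0 < (n : ℝ) / p := by positivity
  set θ := (n : ℝ) / p
  -- Any δ > 0 with θ + δ < 1 would do.
  set δ := (1 - θ) / 2 with hδ
  have hδ0 : 0 < δ := by linarith
  have hC := morreyConst_pos hθ1
  have hC₀ := morreyConst_pos one_pos
  have hθ₂ : θ + δ < 1 := by linarith
  have hC₂ := morreyConst_pos hθ₂
  obtain ⟨K, hK, R, H⟩ := hu.exists_norm_fderiv_mollify_le (one_le_of_natCast_lt hn hp) hn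
    (η := τ / (2 * morreyConst θ)) (by positivity)
  obtain ⟨a, ha0, ha⟩ := exists_rpow_le hθ
    (c := τ / (2 * morreyConst 0 * (K + 1))) (by positivity)
  obtain ⟨b, hb0, hb⟩ := exists_rpow_le hδ0
    (c := τ / (2 * morreyConst (θ + δ) * (K + 1))) (by positivity)
  -- The L^p-small part uses up τ/2; the exponent θ₂ for the remaining part is chosen according to
  -- the regime.
  have key : ∀ (z : EuclideanSpace ℝ (Fin n)) (r : ℝ), 0 < r → ∀ (M₂ θ₂ : ℝ), 0 ≤ M₂ → θ₂ < 1 →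
      (∀ φ : ContDiffBump (0 : EuclideanSpace ℝ (Fin n)), φ.rOut = 2 * φ.rIn → φ.rOut ≤ r →
        ∀ y ∈ ball z (3 * r), ‖fderiv ℝ (mollify φ u) y‖ ≤
          τ / (2 * morreyConst θ) * φ.rOut ^ (-θ) + M₂ * φ.rOut ^ (-θ₂)) →
      morreyConst θ₂ * M₂ * r ^ (θ - θ₂) ≤ τ / 2 →
      ∀ x ∈ closedBall z r, |v x - v z| ≤ τ * r ^ (1 - θ) := by
    intro z r hr M₂ θ₂ hM₂ hθ₂ hH hle x hx
    refine (abs_sub_le_of_norm_fderiv_mollify_le (hv.continuous hp) hr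
      (div_pos hτ (mul_pos two_pos hC)).le hM₂ hθ1 hθ₂ (fun φ hφ hφr y hy ↦ by rw [mollify_congr_ae φ hv.1]; exact hH φ hφ hφr y hy) hx
      (mem_closedBall_self hr.le)).trans ?_
    have e : r ^ (1 - θ₂) = r ^ (θ - θ₂) * r ^ (1 - θ) := by
      rw [← Real.rpow_add hr]
      ring_nf
    have e1 : morreyConst θ * (τ / (2 * morreyConst θ)) = τ / 2 := by field_simp
    rw [e1, e, ← mul_assoc]
    have := mul_le_mul_of_nonneg_right hle (Real.rpow_nonneg hr.le (1 - θ))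
    linarith
  have hsmall : ∀ {C s : ℝ}, 0 < C → s ≤ τ / (2 * C * (K + 1)) → C * K * s ≤ τ / 2 := by
    intro C s hC hs
    calc C * K * s ≤ C * K * (τ / (2 * C * (K + 1))) := by gcongr
      _ = τ / 2 * (K / (K + 1)) := by field_simp
      _ ≤ τ / 2 := mul_le_of_le_one_right (by positivity) ((div_le_one (by positivity)).2 (by simp))
  -- Exponent 0 leaves the factor r^θ, small for small r; exponent θ + δ leaves r^(-δ), small for
  -- large r. Otherwise r ≤ b⁻¹, and 4b⁻¹ covers the ball radius 3r plus the mollification scale, at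
  -- most r, so the compactly supported part is not seen.
  refine ⟨a, b⁻¹, |R| + 4 * b⁻¹, ha0, fun z r hr hcases ↦ ?_⟩
  by_cases hra : r < a
  · refine key z r hr K 0 hK one_pos (fun φ hφ _ y _ ↦ (H φ hφ y).1 0 le_rfl (by positivity)) ?_
    rw [sub_zero]
    exact hsmall hC₀ (ha r hr hra)
  by_cases hrb : b⁻¹ < r
  · refine key z r hr K (θ + δ) hK hθ₂
      (fun φ hφ _ y _ ↦ (H φ hφ y).1 _ (by positivity) (hθ₂.le.trans hn1)) ?_
    rw [sub_add_cancel_left, Real.rpow_neg hr.le, ← Real.inv_rpow hr.le]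
    exact hsmall hC₂ (hb _ (by positivity) (inv_lt_of_inv_lt₀ hb0 hrb))
  · have hz : |R| + 4 * b⁻¹ < ‖z‖ := by tauto
    refine key z r hr 0 0 le_rfl one_pos (fun φ hφ hφr y hy ↦ ?_) (by simpa using (half_pos hτ).le)
    rw [zero_mul, add_zero]
    refine (H φ hφ y).2 ?_
    rw [mem_ball, dist_comm, dist_eq_norm] at hy
    have := norm_sub_norm_le z y
    linarith [le_abs_self R]

end HolderRepresentative

/-! ### Integration against signed measures -/

section SignedMeasure

open Metric Set Filter Topology VectorMeasure

namespace MeasureTheory.SignedMeasure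

variable {X E F : Type*} [MeasurableSpace X] [NormedAddCommGroup E] [NormedSpace ℝ E]
  [NormedAddCommGroup F] [NormedSpace ℝ F] {ρ : SignedMeasure X}

instance isFiniteMeasure_variation (ρ : SignedMeasure X) : IsFiniteMeasure ρ.variation :=
  ρ.totalVariation_eq_variation ▸ inferInstance

theorem integral_eq_sub {f : X → E} (hf : ρ.Integrable f) :
    ∫ᵛ x, f x ∂<•ρ = ∫ x, f x ∂ρ.toJordanDecomposition.posPart -
      ∫ x, f x ∂ρ.toJordanDecomposition.negPart := by
  rw [VectorMeasure.Integrable, ← totalVariation_eq_variation, totalVariation,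
    integrable_add_measure] at hf
  conv_lhs => rw [← ρ.toSignedMeasure_toJordanDecomposition, JordanDecomposition.toSignedMeasure]
  rw [integral_sub_vectorMeasure, integral_toSignedMeasure, integral_toSignedMeasure]
  · simpa [VectorMeasure.Integrable] using hf.1
  · simpa [VectorMeasure.Integrable] using hf.2

theorem integral_clm_comp [CompleteSpace E] [CompleteSpace F] (T : E →L[ℝ] F) {f : X → E}
    (hf : ρ.Integrable f) : ∫ᵛ x, T (f x) ∂<•ρ = T (∫ᵛ x, f x ∂<•ρ) := by
  rw [integral_eq_sub hf, integral_eq_sub (f := fun x ↦ T (f x)) (T.integrable_comp hf), map_sub]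
  rw [VectorMeasure.Integrable, ← totalVariation_eq_variation, totalVariation,
    integrable_add_measure] at hf
  rw [T.integral_comp_comm hf.1, T.integral_comp_comm hf.2]

theorem abs_integral_le_of_bound {f : X → ℝ} {C : ℝ} (h : ∀ᵐ x ∂ρ.variation, |f x| ≤ C) :
    |∫ᵛ x, f x ∂•ρ| ≤ C * ρ.variation.real univ := by
  rcases eq_or_ne ρ.variation 0 with h0 | h0
  -- For zero variation the hypothesis is vacuous and C may be negative.
  · have : f =ᵐ[ρ.variation] 0 := by
      rw [h0, ae_zero]
      exact eventually_bot
    simp [VectorMeasure.integral_eq_zero_of_ae this, h0]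
  have : (ae ρ.variation).NeBot := ae_neBot.2 h0
  obtain ⟨x, hx⟩ := h.exists
  have hC : 0 ≤ C := (abs_nonneg _).trans hx
  have hB : ‖(ContinuousLinearMap.lsmul ℝ ℝ : ℝ →L[ℝ] ℝ →L[ℝ] ℝ)‖ ≤ 1 :=
    ContinuousLinearMap.opNorm_lsmul_le
  have key := VectorMeasure.norm_integral_le_of_norm_le_const (μ := ρ)
    (B := (ContinuousLinearMap.lsmul ℝ ℝ : ℝ →L[ℝ] ℝ →L[ℝ] ℝ)) (f := f) (C := C) h
  exact key.trans (mul_le_mul_of_nonneg_right (mul_le_of_le_one_right hC hB) measureReal_nonneg)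

end MeasureTheory.SignedMeasure

variable {n : ℕ} {ρ : SignedMeasure (EuclideanSpace ℝ (Fin n))}

theorem IsAdmissible.exists_norm_le (hρ : IsAdmissible ρ) :
    ∃ M, 0 < M ∧ ∀ᵐ y ∂ρ.variation, ‖y‖ ≤ M := by
  obtain ⟨M, hM⟩ := hρ.isCompact_support.isBounded.exists_norm_le
  refine ⟨max M 1, by positivity, ?_⟩
  rw [← SignedMeasure.totalVariation_eq_variation]
  filter_upwards [Measure.support_mem_ae (μ := ρ.totalVariation)] with y hy
  exact (hM y hy).trans (le_max_left _ _)

theorem IsAdmissible.pos (hρ : IsAdmissible ρ) : 0 < n := by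
  rcases Nat.eq_zero_or_pos n with rfl | h
  · exact absurd (Subsingleton.elim _ _) hρ.firstMoment_ne_zero
  · exact h

theorem IsAdmissible.integrable {F : Type*} [NormedAddCommGroup F] (hρ : IsAdmissible ρ)
    {f : EuclideanSpace ℝ (Fin n) → F} (hf : Continuous f) : ρ.Integrable f := by
  obtain ⟨M, -, hM⟩ := hρ.exists_norm_le
  obtain ⟨C, hC⟩ := (isCompact_closedBall (0 : EuclideanSpace ℝ (Fin n)) M).exists_bound_of_continuousOn
    hf.continuousOn
  refine Integrable.of_bound hf.aestronglyMeasurable C ?_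
  filter_upwards [hM] with y hy using hC y (mem_closedBall_zero_iff.2 hy)

/-- The translation contributes ρ(ℝⁿ) z = 0. -/
theorem IsAdmissible.firstMoment_map (hρ : IsAdmissible ρ) (c : ℝ)
    (T : EuclideanSpace ℝ (Fin n) →L[ℝ] EuclideanSpace ℝ (Fin n)) (z : EuclideanSpace ℝ (Fin n)) :
    firstMoment (ρ.map fun y ↦ c • T y + z) = c • T (firstMoment ρ) := by
  have hS : Continuous fun y ↦ c • T y + z := by fun_prop
  rw [firstMoment, integral_map (f := fun x ↦ x) hS.measurable
    continuous_id.aestronglyMeasurable (hρ.integrable hS),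
    integral_fun_add (hρ.integrable (by fun_prop)) (hρ.integrable continuous_const), VectorMeasure.integral_const,
    integral_fun_smul, SignedMeasure.integral_clm_comp T (f := fun y ↦ y) (hρ.integrable continuous_id)]
  simp [hρ.univ_eq_zero, firstMoment]

theorem IsAdmissible.integral_map (hρ : IsAdmissible ρ) {u : EuclideanSpace ℝ (Fin n) → ℝ}
    (hu : Continuous u) {S : EuclideanSpace ℝ (Fin n) → EuclideanSpace ℝ (Fin n)}
    (hS : Continuous S) : ∫ᵛ x, u x ∂•(ρ.map S) = ∫ᵛ y, u (S y) ∂•ρ :=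
  VectorMeasure.integral_map hS.measurable hu.aestronglyMeasurable (hρ.integrable (hu.comp hS))

/-- Constants integrate to zero against `ρ`, so that only the oscillation of `u` enters. -/
theorem IsAdmissible.abs_integral_le (hρ : IsAdmissible ρ) {u : EuclideanSpace ℝ (Fin n) → ℝ}
    (hu : Continuous u) {k C : ℝ} (h : ∀ᵐ y ∂ρ.variation, |u y - k| ≤ C) :
    |∫ᵛ y, u y ∂•ρ| ≤ C * ρ.variation.real univ := by
  have : ∫ᵛ y, u y ∂•ρ = ∫ᵛ y, u y - k ∂•ρ := by
    rw [integral_fun_sub (hρ.integrable hu) (hρ.integrable continuous_const), VectorMeasure.integral_const]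
    simp [hρ.univ_eq_zero]
  rw [this]
  exact SignedMeasure.abs_integral_le_of_bound h

end SignedMeasure

/-! ### Compactness and attainment -/

section Attainment

open Metric Set Filter Topology VectorMeasure

variable {n : ℕ} {p : ℝ} {ρ : SignedMeasure (EuclideanSpace ℝ (Fin n))}
  {u v : EuclideanSpace ℝ (Fin n) → ℝ}

/-- The ratio for the push-forward under `y ↦ c • T y + z`, when `T` is an isometry. -/
theorem IsAdmissible.rhoRatio_map (hρ : IsAdmissible ρ) (hv : Continuous v) {c : ℝ} (hc : 0 < c)
    {T : EuclideanSpace ℝ (Fin n) →L[ℝ] EuclideanSpace ℝ (Fin n)} (hT : ∀ y, ‖T y‖ = ‖y‖)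
    (z : EuclideanSpace ℝ (Fin n)) :
    rhoRatio p v (ρ.map fun y ↦ c • T y + z) =
      |∫ᵛ y, v (c • T y + z) ∂•ρ| / (c * ‖firstMoment ρ‖) ^ (1 - (n : ℝ) / p) := by
  rw [rhoRatio, hρ.firstMoment_map, norm_smul, hT, Real.norm_of_nonneg hc.le,
    hρ.integral_map hv (by fun_prop)]

/-- This is the coercivity that confines nearly maximal similarities to a compact set. -/
theorem IsHolderRepresentative.exists_rhoRatio_lt (hρ : IsAdmissible ρ) (hp : (n : ℝ) < p)
    (hu : MemHomSobolev p u) (hv : IsHolderRepresentative p u v) {τ : ℝ} (hτ : 0 < τ) :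
    ∃ a b Z : ℝ, 0 < a ∧ ∀ (c : ℝ)
      (T : EuclideanSpace ℝ (Fin n) →L[ℝ] EuclideanSpace ℝ (Fin n))
      (z : EuclideanSpace ℝ (Fin n)), 0 < c → (∀ y, ‖T y‖ = ‖y‖) → (c < a ∨ b < c ∨ Z < ‖z‖) →
      rhoRatio p v (ρ.map fun y ↦ c • T y + z) < τ := by
  obtain ⟨M, hM0, hM⟩ := hρ.exists_norm_le
  have hm : 0 < ‖firstMoment ρ‖ := norm_pos_iff.2 hρ.firstMoment_ne_zero
  set m := ‖firstMoment ρ‖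
  set α := 1 - (n : ℝ) / p with hα
  set V := ρ.variation.real univ
  have hV : 0 ≤ V := measureReal_nonneg
  have hcont := hv.continuous hp
  obtain ⟨a, b, Z, ha, H⟩ := hv.exists_abs_sub_le hρ.pos hp hu
    -- Converts (cM)^α into (cm)^α; V + 1 in place of V makes the final inequality strict.
    (τ := τ * m ^ α / (M ^ α * (V + 1))) (by positivity)
  refine ⟨a / M, b / M, Z, by positivity, fun c T z hc hT hcases ↦ ?_⟩
  rw [hρ.rhoRatio_map hcont hc hT, ← hα, div_lt_iff₀ (by positivity)]
  have hosc : ∀ᵐ y ∂ρ.variation, |v (c • T y + z) - v z| ≤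
      τ * m ^ α / (M ^ α * (V + 1)) * (c * M) ^ α := by
    filter_upwards [hM] with y hy
    refine H z (c * M) (by positivity) ?_ _ ?_
    · rwa [lt_div_iff₀ hM0, div_lt_iff₀ hM0] at hcases
    · rw [mem_closedBall, dist_eq_norm, add_sub_cancel_right, norm_smul, hT,
        Real.norm_of_nonneg hc.le]
      gcongr
  refine (hρ.abs_integral_le (hcont.comp (by fun_prop)) hosc).trans_lt ?_
  have hpos : 0 < τ * (c * m) ^ α := by positivity
  calc τ * m ^ α / (M ^ α * (V + 1)) * (c * M) ^ α * V
      = τ * (c * m) ^ α * (V / (V + 1)) := by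
        rw [Real.mul_rpow hc.le hM0.le, Real.mul_rpow hc.le hm.le]
        field_simp
    _ < τ * (c * m) ^ α :=
        mul_lt_of_lt_one_right hpos ((div_lt_one (by positivity)).2 (by linarith))

theorem isCompact_setOf_norm_apply_eq :
    IsCompact {T : EuclideanSpace ℝ (Fin n) →L[ℝ] EuclideanSpace ℝ (Fin n) |
      ∀ y, ‖T y‖ = ‖y‖} := by
  refine Metric.isCompact_of_isClosed_isBounded ?_ ?_
  · simp only [ofPred_forall]
    exact isClosed_iInter fun y ↦ isClosed_eq (by fun_prop) continuous_const
  · refine isBounded_iff_forall_norm_le.2 ⟨1, fun T hT ↦ T.opNorm_le_bound zero_le_one fun y ↦ ?_⟩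
    rw [hT y, one_mul]

/-- Dominated convergence: the image points stay in the ball of radius bM + Z, where v is bounded.
-/
theorem IsAdmissible.continuousOn_rhoRatio (hρ : IsAdmissible ρ) (hv : Continuous v) {a b Z : ℝ}
    (ha : 0 < a) (hp : (n : ℝ) < p) :
    ContinuousOn (fun q : ℝ × (EuclideanSpace ℝ (Fin n) →L[ℝ] EuclideanSpace ℝ (Fin n)) ×
        EuclideanSpace ℝ (Fin n) ↦
        |∫ᵛ y, v (q.1 • q.2.1 y + q.2.2) ∂•ρ| / (q.1 * ‖firstMoment ρ‖) ^ (1 - (n : ℝ) / p))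
      (Icc a b ×ˢ {T | ∀ y, ‖T y‖ = ‖y‖} ×ˢ closedBall 0 Z) := by
  obtain ⟨M, hM0, hM⟩ := hρ.exists_norm_le
  have hm : 0 < ‖firstMoment ρ‖ := norm_pos_iff.2 hρ.firstMoment_ne_zero
  obtain ⟨C, hC⟩ := (isCompact_closedBall (0 : EuclideanSpace ℝ (Fin n))
    (b * M + Z)).exists_bound_of_continuousOn hv.continuousOn
  refine ContinuousOn.div ?_ ?_ ?_
  · refine ContinuousOn.abs (continuousOn_of_dominated (bound := fun _ ↦ C) (fun q _ ↦ ?_)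
      ?_ (integrable_const _) (.of_forall fun y ↦ ?_))
    · exact (hv.comp (by fun_prop)).aestronglyMeasurable
    · rintro ⟨c, T, z⟩ ⟨⟨hac, hcb⟩, hT, hz⟩
      filter_upwards [hM] with y hy
      refine hC _ (mem_closedBall_zero_iff.2 ((norm_add_le _ _).trans ?_))
      have hc : 0 < c := ha.trans_le hac
      rw [norm_smul, hT, Real.norm_of_nonneg hc.le]
      exact add_le_add (mul_le_mul hcb hy (norm_nonneg _) (hc.le.trans hcb))
        (mem_closedBall_zero_iff.1 hz)
    · exact (hv.comp (by fun_prop)).continuousOn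
  · exact (Continuous.rpow_const (by fun_prop)
      fun _ ↦ Or.inr (sub_pos.2 (natCast_div_mem_Ico hp).2).le).continuousOn
  · rintro ⟨c, T, z⟩ ⟨⟨hac, -⟩, -⟩
    have hc : 0 < c := ha.trans_le hac
    exact (Real.rpow_pos_of_pos (mul_pos hc hm) _).ne'

/-- In finite dimension a norm-preserving endomorphism is onto, so O(n) becomes a subset of a normed
space, where compactness is available. -/
theorem mem_similarities_iff {S : EuclideanSpace ℝ (Fin n) → EuclideanSpace ℝ (Fin n)} :
    S ∈ similarities n ↔ ∃ (c : ℝ) (T : EuclideanSpace ℝ (Fin n) →L[ℝ] EuclideanSpace ℝ (Fin n))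
      (z : EuclideanSpace ℝ (Fin n)), 0 < c ∧ (∀ y, ‖T y‖ = ‖y‖) ∧ S = fun y ↦ c • T y + z := by
  constructor
  · rintro ⟨c, O, z, hc, rfl⟩
    exact ⟨c, O.toContinuousLinearEquiv, z, hc, O.norm_map, rfl⟩
  · rintro ⟨c, T, z, hc, hT, rfl⟩
    exact ⟨c, LinearIsometry.toLinearIsometryEquiv ⟨T.toLinearMap, hT⟩ rfl, z, hc, rfl⟩

theorem IsHolderRepresentative.exists_isMax_rhoRatio (hρ : IsAdmissible ρ) (hp : (n : ℝ) < p)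
    (hu : MemHomSobolev p u) (hv : IsHolderRepresentative p u v) :
    ∃ S ∈ similarities n, ∀ S' ∈ similarities n,
      rhoRatio p v (ρ.map S') ≤ rhoRatio p v (ρ.map S) := by
  by_cases hpos : ∃ S ∈ similarities n, 0 < rhoRatio p v (ρ.map S)
  swap
  -- All ratios vanish, so the identity is a maximizer.
  · push Not at hpos
    refine ⟨_, mem_similarities_iff.2
      ⟨1, ContinuousLinearMap.id ℝ _, 0, one_pos, fun _ ↦ rfl, rfl⟩,
      fun S' hS' ↦ (hpos S' hS').trans ?_⟩
    rw [rhoRatio]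
    positivity
  obtain ⟨S₁, hS₁, hτ⟩ := hpos
  obtain ⟨c₁, T₁, z₁, hc₁, hT₁, hS₁_eq⟩ := mem_similarities_iff.1 hS₁
  obtain ⟨a, b, Z, ha, H⟩ := hv.exists_rhoRatio_lt hρ hp hu hτ
  have hcont := hv.continuous hp
  set 𝒦 := Icc a b ×ˢ {T : EuclideanSpace ℝ (Fin n) →L[ℝ] EuclideanSpace ℝ (Fin n) |
    ∀ y, ‖T y‖ = ‖y‖} ×ˢ closedBall (0 : EuclideanSpace ℝ (Fin n)) Z
  have hmem : ∀ c T z, 0 < c → (∀ y, ‖T y‖ = ‖y‖) →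
      -- With the positive value at S₁ as threshold, the whole superlevel set lies in 𝒦, so a
      -- maximum over 𝒦 is global.
      rhoRatio p v (ρ.map S₁) ≤ rhoRatio p v (ρ.map fun y ↦ c • T y + z) → (c, T, z) ∈ 𝒦 := by
    intro c T z hc hT hle
    have := fun h ↦ (H c T z hc hT h).not_ge hle
    rw [imp_false, not_or, not_or, not_lt, not_lt, not_lt] at this
    exact ⟨⟨this.1, this.2.1⟩, hT, mem_closedBall_zero_iff.2 this.2.2⟩
  have hK : IsCompact 𝒦 :=
    isCompact_Icc.prod (isCompact_setOf_norm_apply_eq.prod (isCompact_closedBall 0 Z))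
  obtain ⟨⟨c, T, z⟩, ⟨⟨hac, -⟩, hT, -⟩, hmax⟩ := hK.exists_isMaxOn
    ⟨_, hmem c₁ T₁ z₁ hc₁ hT₁ (hS₁_eq ▸ le_rfl)⟩ (hρ.continuousOn_rhoRatio hcont ha hp)
  have hc : 0 < c := ha.trans_le hac
  have hle : ∀ S' ∈ similarities n, rhoRatio p v (ρ.map S₁) ≤ rhoRatio p v (ρ.map S') →
      rhoRatio p v (ρ.map S') ≤ rhoRatio p v (ρ.map fun y ↦ c • T y + z) := by
    intro S' hS' h
    obtain ⟨c', T', z', hc', hT', rfl⟩ := mem_similarities_iff.1 hS'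
    have := isMaxOn_iff.1 hmax _ (hmem c' T' z' hc' hT' h)
    rwa [hρ.rhoRatio_map hcont hc hT, hρ.rhoRatio_map hcont hc' hT']
  refine ⟨_, mem_similarities_iff.2 ⟨c, T, z, hc, hT, rfl⟩, fun S' hS' ↦ ?_⟩
  rcases le_total (rhoRatio p v (ρ.map S₁)) (rhoRatio p v (ρ.map S')) with h | h
  · exact hle S' hS' h
  · exact h.trans (hle S₁ hS₁ le_rfl)

end Attainment

theorem mainTheorem4 (n : ℕ) (p : ℝ) (hp : (n : ℝ) < p)
    (ρ : MeasureTheory.SignedMeasure (EuclideanSpace ℝ (Fin n))) (hρ : IsAdmissible ρ)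
    (u : EuclideanSpace ℝ (Fin n) → ℝ) (hu : MemHomSobolev p u) :
    (∃! v : EuclideanSpace ℝ (Fin n) → ℝ, IsHolderRepresentative p u v) ∧
      ∀ v : EuclideanSpace ℝ (Fin n) → ℝ, IsHolderRepresentative p u v →
        ∃ S ∈ similarities n, rhoSeminorm p ρ v = ENNReal.ofReal (rhoRatio p v (ρ.map S)) := by
  refine ⟨?_, fun v hv ↦ ?_⟩
  · obtain ⟨v, hv⟩ := exists_isHolderRepresentative hρ.pos hp hu
    exact ⟨v, hv, fun w hw ↦ hw.unique hp hv⟩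
  · obtain ⟨S, hS, hmax⟩ := hv.exists_isMax_rhoRatio hρ hp hu
    exact ⟨S, hS, le_antisymm
      (iSup₂_le fun S' hS' ↦ ENNReal.ofReal_le_ofReal (hmax S' hS'))
      (le_iSup₂ (f := fun S' (_ : S' ∈ similarities n) ↦
        ENNReal.ofReal (rhoRatio p v (ρ.map S'))) S hS)⟩
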